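/- A Gauss word is a finite sequence of letters in which every letter that appears does so exactly twice. Two Gauss words are homotopic if they are related by a finite sequence of isomorphisms (bijective relabellings of the letters) and of the following moves between Gauss words and their inverses, where $x,y,z,t$ are possibly empty sequences of letters and $A,B,C$ are letters: $AxAy\leftrightarrow xAyA$; $xAAy\leftrightarrow xy$; $xAByBAz\leftrightarrow xyz$; $xAByACzBCt\leftrightarrow xBAyCAzCBt$. A letter $A$ of a Gauss word $w=xAyAz$ has odd parity if $y$ has an odd number of letters, and even parity otherwise. The covering $\operatorname{cov}(w)$ is obtained from $w$ by deleting all letters of odd parity; the height of $w$ is the least $n\ge 0$ such that $\operatorname{cov}^{n+1}(w)$ is homotopic to $\operatorname{cov}^{n}(w)$ (such an $n$ always exists). The lift of $w$ is obtained from $w$ by replacing, for each letter $A$ of odd parity in $w$, the first occurrence of $A$ by $XAX$, where $X$ is a new letter (a different one for each $A$). **Proposition.** There are infinitely many homotopy classes of Gauss words. More precisely, $\operatorname{cov}(\operatorname{lift}(w))=w$ for every Gauss word $w$, and if $w_0=ABACDCEBED$ and $w_{i+1}=\operatorname{lift}(w_i)$ for $i\ge 0$, then the heights of $w_0,w_1,w_2,\dots$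 are strictly increasing and the words $w_i$ are pairwise non-homotopic. -/

import Mathlib

/-- A Gauss word: a finite sequence of letters in which every letter that appears does so
exactly twice.  Letters are named by natural numbers; the alphabet of the word is the finite set
of the letters appearing in it. -/
@[ext]
structure GaussWord where
  letters : List ℕ
  count_eq_two : ∀ a ∈ letters, letters.count a = 2

namespace GaussWord

/-- The elementary transformations on sequences of letters: relabelling by a map that is
injective on the letters in use (so a bijection between the two alphabets), and the homotopy
moves, written in one direction. -/
inductive Move : List ℕ → List ℕ → Prop
  | iso (u : List ℕ) (f : ℕ → ℕ) (hf : Set.InjOn f {a | a ∈ u}) : Move u (u.map f)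
  | shift (A : ℕ) (x y : List ℕ) : Move ([A] ++ x ++ [A] ++ y) (x ++ [A] ++ y ++ [A])
  | h1 (A : ℕ) (x y : List ℕ) : Move (x ++ [A, A] ++ y) (x ++ y)
  | h2 (A B : ℕ) (x y z : List ℕ) : Move (x ++ [A, B] ++ y ++ [B, A] ++ z) (x ++ y ++ z)
  | h3 (A B C : ℕ) (x y z t : List ℕ) :
      Move (x ++ [A, B] ++ y ++ [A, C] ++ z ++ [B, C] ++ t)
        (x ++ [B, A] ++ y ++ [C, A] ++ z ++ [C, B] ++ t)

/-- Homotopy of Gauss words: the equivalence relation generated by isomorphisms and homotopy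
moves between Gauss words.  Each word in the sequence of moves is a Gauss word; in particular the
letters displayed in a move are automatically distinct from each other and from the rest. -/
def Homotopic : GaussWord → GaussWord → Prop :=
  Relation.EqvGen fun u v => Move u.letters v.letters

/-- Homotopy as a setoid. -/
def homotopySetoid : Setoid GaussWord := Relation.EqvGen.setoid fun u v => Move u.letters v.letters

/-- The set of homotopy classes of Gauss words. -/
def HomotopyClass : Type := Quotient homotopySetoid

/-- The number of letters strictly between the first two occurrences of `a` in `w`. -/
def gap (w : List ℕ) (a : ℕ) : ℕ := (w.drop (w.idxOf a + 1)).idxOf a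

/-- `a` has odd parity in `w`: there is an odd number of letters between its occurrences. -/
abbrev OddParity (w : List ℕ) (a : ℕ) : Prop := Odd (gap w a)

/-- If the Gauss word `w` has the form `x a y a z`, then `gap` is the length of `y`. -/
theorem gap_eq (w : GaussWord) (a : ℕ) (x y z : List ℕ)
    (h : w.letters = x ++ a :: (y ++ a :: z)) : gap w.letters a = y.length := by
  have hc := w.count_eq_two a (by simp [h])
  rw [h] at hc
  simp only [List.count_append, List.count_cons_self] at hc
  have hx : a ∉ x := List.count_eq_zero.1 (by omega)
  have hy : a ∉ y := List.count_eq_zero.1 (by omega)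
  have hi : (x ++ a :: (y ++ a :: z)).idxOf a = x.length := by
    simp [List.idxOf_append_of_notMem hx]
  have hd : (x ++ a :: (y ++ a :: z)).drop (x.length + 1) = y ++ a :: z := by
    simp [List.drop_append]
  unfold gap
  rw [h, hi, hd]
  simp [List.idxOf_append_of_notMem hy]

/-- The (even parity) covering of a Gauss word: delete all letters of odd parity. -/
def cover (w : GaussWord) : GaussWord where
  letters := w.letters.filter fun a => ¬ OddParity w.letters a
  count_eq_two := by
    intro a ha
    rw [List.mem_filter] at ha
    exact (List.count_filter (p := fun a => decide (¬ OddParity w.letters a)) ha.2).trans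
      (w.count_eq_two a ha.1)

/-- Iterated coverings become stationary, so the height below is a genuine minimum. -/
theorem exists_homotopic_cover (w : GaussWord) :
    {n : ℕ | Homotopic (cover^[n + 1] w) (cover^[n] w)}.Nonempty := by
  have key : ∀ (k : ℕ) (v : GaussWord), v.letters.length ≤ k →
      ∃ n, cover^[n + 1] v = cover^[n] v := by
    intro k
    induction k with
    | zero =>
      intro v hv
      refine ⟨0, ?_⟩
      have h0 : v.letters = [] := List.length_eq_zero_iff.1 (by omega)
      ext1
      simp [cover, h0]
    | succ k ih =>
      intro v hv
      by_cases hl : (cover v).letters.length = v.letters.length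
      · refine ⟨0, ?_⟩
        ext1
        exact (List.filter_sublist).eq_of_length hl
      · have hle : (cover v).letters.length ≤ v.letters.length :=
          (List.filter_sublist).length_le
        obtain ⟨n, hn⟩ := ih (cover v) (by omega)
        exact ⟨n + 1, by simpa [Function.iterate_succ_apply] using hn⟩
  obtain ⟨n, hn⟩ := key _ w le_rfl
  exact ⟨n, by change Homotopic _ _; rw [hn]; exact Relation.EqvGen.refl _⟩

/-- The height of `w`: the least `n` such that the `(n+1)`-st and the `n`-th iterated coverings
of `w` are homotopic. -/
noncomputable def height (w : GaussWord) : ℕ :=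
  sInf {n : ℕ | Homotopic (cover^[n + 1] w) (cover^[n] w)}

/-- A letter attached to `a` which does not appear in `w`; different letters `a` give
different new letters. -/
def fresh (w : List ℕ) (a : ℕ) : ℕ := w.sum + 1 + a

/-- Replace `a` by `X a X` with `X = new a` at each position where `odd a` holds and `a` appears
again later on.  In a Gauss word these are the first occurrences of the letters with `odd a`. -/
def insertNew (odd : ℕ → Prop) [DecidablePred odd] (new : ℕ → ℕ) : List ℕ → List ℕ
  | [] => []
  | a :: l =>
    if odd a ∧ a ∈ l then [new a, a, new a] ++ insertNew odd new l
    else a :: insertNew odd new l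

theorem count_insertNew_old (odd : ℕ → Prop) [DecidablePred odd] (new : ℕ → ℕ) (c : ℕ)
    (hc : ∀ a, new a ≠ c) (l : List ℕ) : (insertNew odd new l).count c = l.count c := by
  induction l with
  | nil => rfl
  | cons a l ih =>
    unfold insertNew
    split_ifs with h
    · simp [List.count_cons, ih, hc]
    · simp [List.count_cons, ih]

theorem count_insertNew_new (odd : ℕ → Prop) [DecidablePred odd] (new : ℕ → ℕ)
    (hinj : Function.Injective new) (b : ℕ) (l : List ℕ) (hb : new b ∉ l) :
    (insertNew odd new l).count (new b) = if odd b then 2 * (l.count b - 1) else 0 := by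
  induction l with
  | nil => simp [insertNew]
  | cons a l ih =>
    simp only [List.mem_cons, not_or] at hb
    have ih := ih hb.2
    have hne : a ≠ new b := fun h => hb.1 h.symm
    unfold insertNew
    by_cases hab : a = b
    · subst hab
      by_cases ho : odd a
      · by_cases hm : a ∈ l
        · have : 0 < l.count a := List.count_pos_iff.2 hm
          simp only [ho, hm, and_self, if_true] at ih ⊢
          simp [ih, hne]
          omega
        · have : l.count a = 0 := List.count_eq_zero.2 hm
          simp only [ho, hm, and_false, if_false, if_true] at ih ⊢
          simp [ih, hne, this]
      · simp only [ho, false_and, if_false] at ih ⊢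
        simp [ih, hne]
    · have h2 : new a ≠ new b := fun h => hab (hinj h)
      split_ifs with h3 h4 h4 <;> simp_all

theorem mem_insertNew (odd : ℕ → Prop) [DecidablePred odd] (new : ℕ → ℕ) (c : ℕ) (l : List ℕ)
    (h : c ∈ insertNew odd new l) : c ∈ l ∨ ∃ b ∈ l, c = new b := by
  induction l with
  | nil => simp [insertNew] at h
  | cons a l ih =>
    unfold insertNew at h
    split_ifs at h with h1
    · simp only [List.cons_append, List.nil_append, List.mem_cons] at h
      rcases h with h | h | h | h
      · exact Or.inr ⟨a, by simp, h⟩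
      · exact Or.inl (by simp [h])
      · exact Or.inr ⟨a, by simp, h⟩
      · rcases ih h with h | ⟨b, hb, h⟩
        · exact Or.inl (by simp [h])
        · exact Or.inr ⟨b, by simp [hb], h⟩
    · rcases List.mem_cons.1 h with h | h
      · exact Or.inl (by simp [h])
      · rcases ih h with h | ⟨b, hb, h⟩
        · exact Or.inl (by simp [h])
        · exact Or.inr ⟨b, by simp [hb], h⟩

/-- The lift of a Gauss word `w`: for each letter `A` of odd parity in `w`, the first occurrence
of `A` is replaced by `XAX`, where `X` is a new letter. -/
def lift (w : GaussWord) : GaussWord where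
  letters := insertNew (OddParity w.letters) (fresh w.letters) w.letters
  count_eq_two := by
    intro c hc
    have hinj : Function.Injective (fresh w.letters) := by
      intro a b h
      simpa [fresh] using h
    have hlt : ∀ a ∈ w.letters, ∀ b, a < fresh w.letters b := by
      intro a ha b
      have := List.le_sum_of_mem ha
      unfold fresh
      omega
    rcases mem_insertNew _ _ _ _ hc with h | ⟨b, hb, rfl⟩
    · rw [count_insertNew_old _ _ _ (fun a => (hlt c h a).ne')]
      exact w.count_eq_two c h
    · have hpos := List.count_pos_iff.2 hc
      have hn : fresh w.letters b ∉ w.letters := fun h => lt_irrefl _ (hlt _ h b)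
      rw [count_insertNew_new _ _ hinj b _ hn, w.count_eq_two b hb] at hpos ⊢
      split_ifs at hpos ⊢ <;> omega

/-- The Gauss word `ABACDCEBED`, with `A, B, C, D, E` named `0, 1, 2, 3, 4`. -/
def exampleWord : GaussWord where
  letters := [0, 1, 0, 2, 3, 2, 4, 1, 4, 3]
  count_eq_two := by decide

end GaussWord

/-!
The parity of a letter `c` is read off the alternating count `altCount c w`, the sum of `(-1) ^ p`
over the positions `p` of `c`: it vanishes exactly when `c` is even. Counts of this kind are
additive under concatenation up to signs, so their behaviour under the moves is a direct computation.

The moves respect parity: the letters that a move does not delete keep theirs, the letter deleted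
by the first move is even, the two letters deleted by the second have the same parity, and among
the three letters of the third move `0` or `2` are odd. Hence the covering turns a move into a move
or an equality (`homotopic_cover_of_move`), and covering and height are homotopy invariants. In the
lift of `w` every old letter is even and every new letter is odd, so `cov (lift w) = w`
(`cover_lift`), and therefore `height (lift w) > height w` as soon as `height w > 0`
(`height_lt_height_lift`).

It remains to show that `ABACDCEBED` is not homotopic to its covering `DD`. For this, let every odd
letter with first position `p` and linked with `m` even letters contribute `(-1) ^ (p + m)`. The sum
of these contributions is preserved by all moves up to a global sign (`sq_oddSum_of_move`). It is
`4` for `ABACDCEBED` and `0` for `DD`; `oddSum` is four times this sum.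
-/

namespace GaussWord

/-! ### Signed counts of letters -/

/-- The product of the signs `s a` over the letters `a` of `l`. -/
def signProd (s : ℕ → ℤ) (l : List ℕ) : ℤ := (l.map s).prod

/-- The sum, over the positions of the letter `c` in the sequence, of the product of the signs of
the preceding letters. -/
def signedCount (s : ℕ → ℤ) (c : ℕ) : List ℕ → ℤ
  | [] => 0
  | a :: l => (if a = c then 1 else 0) + s a * signedCount s c l

/-- The sum of `(-1) ^ p` over the positions `p` of `c` in `l`, numbered from `0`. For a letter of a
Gauss word it is `0` if the letter is even, and `2` or `-2` if it is odd. -/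
abbrev altCount (c : ℕ) (l : List ℕ) : ℤ := signedCount (fun _ => -1) c l

section signs

variable (s : ℕ → ℤ)

@[simp] theorem signProd_nil : signProd s [] = 1 := rfl

@[simp] theorem signProd_cons (a : ℕ) (l : List ℕ) :
    signProd s (a :: l) = s a * signProd s l := by simp [signProd]

@[simp] theorem signProd_append (x y : List ℕ) :
    signProd s (x ++ y) = signProd s x * signProd s y := by simp [signProd]

theorem signProd_eq_or (hs : ∀ a, s a = 1 ∨ s a = -1) (l : List ℕ) :
    signProd s l = 1 ∨ signProd s l = -1 := by
  induction l with
  | nil => simp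
  | cons a l ih =>
    rcases hs a with h | h <;> rcases ih with h' | h' <;> simp [h, h']

theorem signProd_neg_one (l : List ℕ) : signProd (fun _ => -1) l = (-1) ^ l.length := by
  simp [signProd]

@[simp] theorem signedCount_nil (c : ℕ) : signedCount s c [] = 0 := rfl

@[simp] theorem signedCount_cons (c a : ℕ) (l : List ℕ) :
    signedCount s c (a :: l) = (if a = c then 1 else 0) + s a * signedCount s c l := rfl

@[simp] theorem signedCount_append (c : ℕ) (x y : List ℕ) :
    signedCount s c (x ++ y) = signedCount s c x + signProd s x * signedCount s c y := by
  induction x with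
  | nil => simp
  | cons a x ih => simp [ih]; ring

theorem signedCount_of_notMem {c : ℕ} {l : List ℕ} (h : c ∉ l) : signedCount s c l = 0 := by
  induction l with
  | nil => rfl
  | cons a l ih =>
    simp only [List.mem_cons, not_or] at h
    simp [ih h.2, Ne.symm h.1]

theorem signedCount_congr {s s' : ℕ → ℤ} (c : ℕ) {l : List ℕ} (h : ∀ a ∈ l, s a = s' a) :
    signedCount s c l = signedCount s' c l := by
  induction l with
  | nil => rfl
  | cons a l ih =>
    rw [signedCount_cons, signedCount_cons, h a (by simp),
      ih fun b hb => h b (List.mem_cons_of_mem a hb)]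

theorem signedCount_map (f : ℕ → ℕ) (c : ℕ) (l : List ℕ) (h : ∀ a ∈ l, f a = f c → a = c) :
    signedCount s (f c) (l.map f) = signedCount (s ∘ f) c l := by
  induction l with
  | nil => rfl
  | cons a l ih =>
    have ha : f a = f c ↔ a = c := ⟨h a (by simp), congrArg f⟩
    simp [ih fun b hb => h b (List.mem_cons_of_mem a hb), ha]

end signs

theorem altCount_eq_or {c : ℕ} {l : List ℕ} (h : l.count c = 1) :
    altCount c l = 1 ∨ altCount c l = -1 := by
  induction l with
  | nil => simp at h
  | cons a l ih =>
    by_cases hac : a = c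
    · subst hac
      have : a ∉ l := List.count_eq_zero.1 (by simpa using h)
      simp [altCount, signedCount_of_notMem _ this]
    · have := ih (by simpa [List.count_cons, hac] using h)
      rcases this with h | h <;> simp [altCount] at h ⊢ <;> simp [hac, h]

/-! ### Parity -/

theorem exists_eq_append_of_count_eq_two {w : List ℕ} {a : ℕ} (h : w.count a = 2) :
    ∃ x y z, w = x ++ a :: (y ++ a :: z) ∧ a ∉ x ∧ a ∉ y ∧ a ∉ z := by
  have h1 : a ∈ w := List.count_pos_iff.1 (by omega)
  obtain ⟨x, v, rfl, hx⟩ := List.eq_append_cons_of_mem h1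
  have hv : v.count a = 1 := by
    simp [List.count_eq_zero.2 hx] at h; omega
  obtain ⟨y, z, rfl, hy⟩ :=
    List.eq_append_cons_of_mem (List.count_pos_iff.1 (by omega : 0 < v.count a))
  refine ⟨x, y, z, rfl, hx, hy, List.count_eq_zero.1 ?_⟩
  simp [List.count_eq_zero.2 hy] at hv
  simpa using hv

theorem oddParity_iff (w : GaussWord) {a : ℕ} (ha : a ∈ w.letters) :
    OddParity w.letters a ↔ altCount a w.letters ≠ 0 := by
  obtain ⟨x, y, z, h, hx, hy, hz⟩ := exists_eq_append_of_count_eq_two (w.count_eq_two a ha)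
  rw [OddParity, gap_eq w a x y z h, h]
  simp only [altCount, signedCount_append, signedCount_cons, signedCount_of_notMem _ hx,
    signedCount_of_notMem _ hy, signedCount_of_notMem _ hz, signProd_neg_one]
  rcases Nat.even_or_odd y.length with h' | h'
  · simp [h'.neg_one_pow, h']
  · simp [h'.neg_one_pow, h']

theorem cover_letters (w : GaussWord) :
    w.cover.letters = w.letters.filter fun a => altCount a w.letters = 0 := by
  apply List.filter_congr
  intro a ha
  simp [-Nat.not_odd_iff_even, oddParity_iff w ha]

/-! ### The covering of the lift -/

section lift

variable (odd : ℕ → Prop) [DecidablePred odd] (new : ℕ → ℕ)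

/-- An insertion around another letter shifts all later positions by `2`. Nothing is inserted around
`c` itself if it is even, or if it does not appear twice. -/
theorem altCount_insertNew_old {c : ℕ} (hc : ∀ a, new a ≠ c) {l : List ℕ}
    (h : ¬ odd c ∨ l.count c ≤ 1) : altCount c (insertNew odd new l) = altCount c l := by
  induction l with
  | nil => rfl
  | cons a l ih =>
    have ih := ih (h.imp_right fun h => (List.count_le_count_cons).trans h)
    simp only [altCount] at ih ⊢
    unfold insertNew
    split_ifs with h1
    · have hac : a ≠ c := by
        rintro rfl
        have := List.count_pos_iff.2 h1.2
        rcases h with h | h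
        · exact h h1.1
        · simp at h; omega
      simp [hc, hac, ih]
    · simp [ih]

/-- The insertion moves the first occurrence of an odd letter by one position, relative to its
second occurrence. -/
theorem altCount_insertNew_old_odd {c : ℕ} (hc : ∀ a, new a ≠ c) (ho : odd c) {l : List ℕ}
    (h : l.count c = 2) (h0 : altCount c l ≠ 0) : altCount c (insertNew odd new l) = 0 := by
  induction l with
  | nil => rfl
  | cons a l ih =>
    by_cases hac : a = c
    · subst hac
      have h1 : l.count a = 1 := by simpa using h
      have hm : a ∈ l := List.count_pos_iff.1 (by omega)
      have h2 := altCount_insertNew_old odd new hc (Or.inr h1.le)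
      have h3 := altCount_eq_or h1
      simp only [altCount] at h0 h2 h3 ⊢
      simp [insertNew, ho, hm, hc, h2] at h0 ⊢
      omega
    · have ih := ih (by simpa [List.count_cons, hac] using h)
        (by simpa [altCount, hac] using h0)
      simp only [altCount] at ih ⊢
      unfold insertNew
      split_ifs <;> simp [hc, hac, ih]

theorem altCount_insertNew_new (hinj : Function.Injective new) {b : ℕ} {l : List ℕ}
    (hb : new b ∉ l) (h : l.count b ≤ 2) (hm : new b ∈ insertNew odd new l) :
    altCount (new b) (insertNew odd new l) ≠ 0 := by
  induction l with
  | nil => simp [insertNew] at hm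
  | cons a l ih =>
    simp only [List.mem_cons, not_or] at hb
    by_cases hab : a = b
    · subst hab
      have hl : new a ∉ insertNew odd new l := by
        rw [← List.count_eq_zero, count_insertNew_new odd new hinj a l hb.2]
        simp at h
        split_ifs <;> omega
      have hl' := signedCount_of_notMem (fun _ => -1) hl
      unfold insertNew at hm ⊢
      split_ifs at hm ⊢ with h1
      · simp [altCount, hl', Ne.symm hb.1]
      · simp [hb.1, hl] at hm
    · have hne : new a ≠ new b := fun h => hab (hinj h)
      have ih := ih hb.2 (List.count_le_count_cons.trans h)
      simp only [altCount] at ih ⊢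
      unfold insertNew at hm ⊢
      split_ifs at hm ⊢ with h1
      · simp [hb.1, hne.symm] at hm
        simpa [hne, Ne.symm hb.1] using ih hm
      · simp [hb.1] at hm
        simpa [Ne.symm hb.1] using ih hm

theorem filter_insertNew (p : ℕ → Bool) {l : List ℕ}
    (hnew : ∀ b, new b ∈ insertNew odd new l → p (new b) = false) (hold : ∀ a ∈ l, p a = true) :
    (insertNew odd new l).filter p = l := by
  induction l with
  | nil => rfl
  | cons a l ih =>
    have h2 := hold a (by simp)
    unfold insertNew at hnew ⊢
    split_ifs at hnew ⊢ with h
    · have h1 := hnew a (by simp)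
      simp [h1, h2, ih (fun b hb => hnew b (by simp [hb])) fun a ha => hold a (by simp [ha])]
    · simp [h2, ih (fun b hb => hnew b (by simp [hb])) fun a ha => hold a (by simp [ha])]

end lift

theorem fresh_injective (w : List ℕ) : Function.Injective (fresh w) := fun a b h => by
  simpa [fresh] using h

theorem fresh_ne {w : List ℕ} {a : ℕ} (ha : a ∈ w) (b : ℕ) : fresh w b ≠ a := by
  have := List.le_sum_of_mem ha
  unfold fresh
  omega

theorem cover_lift (w : GaussWord) : w.lift.cover = w := by
  ext1
  rw [cover_letters]
  apply filter_insertNew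
  · intro b hb
    have hn : fresh w.letters b ∉ w.letters := fun h => fresh_ne h b rfl
    have hle : w.letters.count b ≤ 2 := by
      by_cases h : b ∈ w.letters
      · exact (w.count_eq_two b h).le
      · simp [List.count_eq_zero.2 h]
    exact decide_eq_false
      (altCount_insertNew_new _ _ (fresh_injective _) hn hle hb)
  · intro a ha
    apply decide_eq_true
    by_cases ho : OddParity w.letters a
    · exact altCount_insertNew_old_odd _ _ (fresh_ne ha) ho (w.count_eq_two a ha)
        ((oddParity_iff w ha).1 ho)
    · exact (altCount_insertNew_old _ _ (fresh_ne ha) (Or.inl ho)).trans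
        (not_not.1 fun h => ho ((oddParity_iff w ha).2 h))

/-- Every letter of a Gauss word enters the product twice. -/
theorem signProd_eq_one (w : GaussWord) {s : ℕ → ℤ} (hs : ∀ a, s a = 1 ∨ s a = -1) :
    signProd s w.letters = 1 := by
  rw [signProd, Finset.prod_list_map_count]
  refine Finset.prod_eq_one fun a ha => ?_
  rw [w.count_eq_two a (List.mem_toFinset.1 ha)]
  rcases hs a with h | h <;> simp [h]

theorem neg_one_sign (a : ℕ) : (fun _ => -1 : ℕ → ℤ) a = 1 ∨ (fun _ => -1 : ℕ → ℤ) a = -1 :=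
  Or.inr rfl

/-! ### The letters displayed in a move -/

theorem notMem_of_shift {w : GaussWord} {A : ℕ} {x y : List ℕ}
    (h : w.letters = [A] ++ x ++ [A] ++ y) : A ∉ x ∧ A ∉ y := by
  have hA := w.count_eq_two A (by simp [h])
  simp only [h, List.count_append, List.count_cons, List.count_nil, beq_self_eq_true, if_true] at hA
  exact ⟨List.count_eq_zero.1 (by omega), List.count_eq_zero.1 (by omega)⟩

theorem notMem_of_h1 {w : GaussWord} {A : ℕ} {x y : List ℕ}
    (h : w.letters = x ++ [A, A] ++ y) : A ∉ x ∧ A ∉ y := by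
  have hA := w.count_eq_two A (by simp [h])
  simp only [h, List.count_append, List.count_cons, List.count_nil, beq_self_eq_true, if_true] at hA
  exact ⟨List.count_eq_zero.1 (by omega), List.count_eq_zero.1 (by omega)⟩

theorem notMem_of_h2 {w : GaussWord} {A B : ℕ} {x y z : List ℕ}
    (h : w.letters = x ++ [A, B] ++ y ++ [B, A] ++ z) :
    A ≠ B ∧ (A ∉ x ∧ A ∉ y ∧ A ∉ z) ∧ (B ∉ x ∧ B ∉ y ∧ B ∉ z) := by
  have hA := w.count_eq_two A (by simp [h])
  have hB := w.count_eq_two B (by simp [h])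
  simp only [h, List.count_append, List.count_cons, List.count_nil, beq_self_eq_true,
    if_true] at hA hB
  refine ⟨?_, ⟨?_, ?_, ?_⟩, ?_, ?_, ?_⟩
  · rintro rfl
    simp only [beq_self_eq_true, if_true] at hA
    omega
  all_goals exact List.count_eq_zero.1 (by omega)

theorem notMem_of_h3 {w : GaussWord} {A B C : ℕ} {x y z t : List ℕ}
    (h : w.letters = x ++ [A, B] ++ y ++ [A, C] ++ z ++ [B, C] ++ t) :
    (A ≠ B ∧ A ≠ C ∧ B ≠ C) ∧ (A ∉ x ∧ A ∉ y ∧ A ∉ z ∧ A ∉ t) ∧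
      (B ∉ x ∧ B ∉ y ∧ B ∉ z ∧ B ∉ t) ∧ (C ∉ x ∧ C ∉ y ∧ C ∉ z ∧ C ∉ t) := by
  have hA := w.count_eq_two A (by simp [h])
  have hB := w.count_eq_two B (by simp [h])
  have hC := w.count_eq_two C (by simp [h])
  simp only [h, List.count_append, List.count_cons, List.count_nil, beq_self_eq_true,
    if_true] at hA hB hC
  refine ⟨⟨?_, ?_, ?_⟩, ⟨?_, ?_, ?_, ?_⟩, ⟨?_, ?_, ?_, ?_⟩, ?_, ?_, ?_, ?_⟩
  · rintro rfl
    simp only [beq_self_eq_true, if_true] at hA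
    omega
  · rintro rfl
    simp only [beq_self_eq_true, if_true] at hA
    omega
  · rintro rfl
    simp only [beq_self_eq_true, if_true] at hB
    omega
  all_goals exact List.count_eq_zero.1 (by omega)

/-! ### Signed counts and parity under the moves -/

/-- Each position after the shifted letter `A` loses the factor `s A`; the moved occurrence of `A`
gains the product of the signs of all other positions, which is `s A` as the total is `1`. -/
theorem signedCount_shift {w : GaussWord} {A : ℕ} {x y : List ℕ}
    (h : w.letters = [A] ++ x ++ [A] ++ y) {s : ℕ → ℤ} (hs : ∀ a, s a = 1 ∨ s a = -1) (c : ℕ) :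
    signedCount s c (x ++ [A] ++ y ++ [A]) = s A * signedCount s c w.letters := by
  obtain ⟨hx, hy⟩ := notMem_of_shift h
  have hp := signProd_eq_one w hs
  have hA : s A * s A = 1 := by rcases hs A with h | h <;> simp [h]
  rw [h] at hp ⊢
  by_cases hc : A = c
  · subst hc
    simp [signedCount_of_notMem s hx, signedCount_of_notMem s hy] at hp ⊢
    linear_combination s A * hp - signProd s x * hA - signProd s x * s A * signProd s y * hA
  · simp [hc]
    linear_combination -(signedCount s c x + signProd s x * s A * signedCount s c y) * hA

theorem signedCount_h1 {w : GaussWord} {A : ℕ} {x y : List ℕ}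
    (h : w.letters = x ++ [A, A] ++ y) {s : ℕ → ℤ} (hs : ∀ a, s a = 1 ∨ s a = -1) {c : ℕ}
    (hc : c ≠ A) : signedCount s c (x ++ y) = signedCount s c w.letters := by
  have hA : s A * s A = 1 := by rcases hs A with h | h <;> simp [h]
  rw [h]
  simp [hc.symm, ← mul_assoc (s A), hA]

theorem signedCount_h2 {w : GaussWord} {A B : ℕ} {x y z : List ℕ}
    (h : w.letters = x ++ [A, B] ++ y ++ [B, A] ++ z) {s : ℕ → ℤ} (hAB : s A = s B)
    (hs : ∀ a, s a = 1 ∨ s a = -1) {c : ℕ} (hcA : c ≠ A) (hcB : c ≠ B) :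
    signedCount s c (x ++ y ++ z) = signedCount s c w.letters := by
  have hA : s B * s B = 1 := by rcases hs B with h | h <;> simp [h]
  rw [h]
  simp [hcA.symm, hcB.symm, hAB, ← mul_assoc, hA]

theorem signedCount_h3 {A B C : ℕ} (x y z t : List ℕ) (s : ℕ → ℤ) {c : ℕ}
    (hcA : c ≠ A) (hcB : c ≠ B) (hcC : c ≠ C) :
    signedCount s c (x ++ [B, A] ++ y ++ [C, A] ++ z ++ [C, B] ++ t) =
      signedCount s c (x ++ [A, B] ++ y ++ [A, C] ++ z ++ [B, C] ++ t) := by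
  simp only [signedCount_append, signedCount_cons, signedCount_nil, signProd_append, signProd_cons,
    signProd_nil, if_neg hcA.symm, if_neg hcB.symm, if_neg hcC.symm]
  ring

theorem altCount_h3 {w : GaussWord} {A B C : ℕ} {x y z t : List ℕ}
    (h : w.letters = x ++ [A, B] ++ y ++ [A, C] ++ z ++ [B, C] ++ t) {c : ℕ}
    (hc : c = A ∨ c = B ∨ c = C) :
    altCount c (x ++ [B, A] ++ y ++ [C, A] ++ z ++ [C, B] ++ t) = -altCount c w.letters := by
  obtain ⟨⟨hAB, hAC, hBC⟩, ⟨h1, h2, h3, h4⟩, ⟨h5, h6, h7, h8⟩, h9, h10, h11, h12⟩ :=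
    notMem_of_h3 h
  rw [h]
  rcases hc with rfl | rfl | rfl <;>
    simp only [altCount, signedCount_append, signedCount_cons, signedCount_nil, signProd_append,
      signProd_cons, signProd_nil, signedCount_of_notMem, if_true, if_neg, not_false_eq_true, *,
      hAB.symm, hAC.symm, hBC.symm] <;> ring

/-- The number of odd letters among the three letters of a third move is `0` or `2`. -/
theorem altCount_h3_eq_zero {w : GaussWord} {A B C : ℕ} {x y z t : List ℕ}
    (h : w.letters = x ++ [A, B] ++ y ++ [A, C] ++ z ++ [B, C] ++ t) :
    (altCount A w.letters = 0 ∧ altCount B w.letters = 0 ∧ altCount C w.letters = 0) ∨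
    (altCount A w.letters = 0 ∧ altCount B w.letters ≠ 0 ∧ altCount C w.letters ≠ 0) ∨
    (altCount A w.letters ≠ 0 ∧ altCount B w.letters = 0 ∧ altCount C w.letters ≠ 0) ∨
    (altCount A w.letters ≠ 0 ∧ altCount B w.letters ≠ 0 ∧ altCount C w.letters = 0) := by
  obtain ⟨⟨hAB, hAC, hBC⟩, ⟨h1, h2, h3, h4⟩, ⟨h5, h6, h7, h8⟩, h9, h10, h11, h12⟩ :=
    notMem_of_h3 h
  rw [h]
  rcases signProd_eq_or _ neg_one_sign x with hx | hx <;>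
  rcases signProd_eq_or _ neg_one_sign y with hy | hy <;>
  rcases signProd_eq_or _ neg_one_sign z with hz | hz <;>
  simp [signedCount_of_notMem, *, hAB.symm, hBC.symm]

theorem altCount_h1 {w : GaussWord} {A : ℕ} {x y : List ℕ}
    (h : w.letters = x ++ [A, A] ++ y) : altCount A w.letters = 0 := by
  obtain ⟨hx, hy⟩ := notMem_of_h1 h
  rw [h]
  simp [signedCount_of_notMem, *]

theorem altCount_h2 {w : GaussWord} {A B : ℕ} {x y z : List ℕ}
    (h : w.letters = x ++ [A, B] ++ y ++ [B, A] ++ z) :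
    altCount A w.letters = -altCount B w.letters := by
  obtain ⟨hAB, ⟨h1, h2, h3⟩, h4, h5, h6⟩ := notMem_of_h2 h
  rw [h]
  simp [signedCount_of_notMem, *, hAB.symm]
  ring

theorem altCount_shift {w : GaussWord} {A : ℕ} {x y : List ℕ}
    (h : w.letters = [A] ++ x ++ [A] ++ y) (c : ℕ) :
    altCount c (x ++ [A] ++ y ++ [A]) = - altCount c w.letters := by
  rw [altCount, signedCount_shift h neg_one_sign]; simp

/-! ### Homotopy invariance of the covering and the height -/

theorem Homotopic.of_move {u v : GaussWord} (h : Move u.letters v.letters) : Homotopic u v :=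
  Relation.EqvGen.rel _ _ h

theorem Homotopic.of_eq {u v : GaussWord} (h : u.letters = v.letters) : Homotopic u v := by
  rw [GaussWord.ext h]
  exact Relation.EqvGen.refl _

/-- A move either survives in the covering as a move of the same kind, or, if it displays an odd
letter, makes the two coverings equal. -/
theorem homotopic_cover_of_move {u v : GaussWord} (h : Move u.letters v.letters) :
    Homotopic u.cover v.cover := by
  generalize hu : u.letters = l at h
  generalize hv : v.letters = l' at h
  have hcv : ∀ p : ℕ → Prop, ∀ [DecidablePred p], (∀ c ∈ l', altCount c l' = 0 ↔ p c) →
      v.cover.letters = l'.filter p := by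
    intro p _ hp
    rw [cover_letters, hv]
    exact List.filter_congr fun c hc => by simpa using hp c hc
  have hcu : u.cover.letters = l.filter fun c => altCount c u.letters = 0 := by
    rw [cover_letters, hu]
  cases h with
  | iso _ f hf =>
    apply Homotopic.of_move
    rw [cover_letters v, hcu, hv, List.filter_map]
    have : l.filter ((fun a => decide (altCount a (l.map f) = 0)) ∘ f) =
        l.filter fun c => altCount c u.letters = 0 := by
      refine List.filter_congr fun c hc => ?_
      rw [Function.comp_apply, hu, altCount,
        signedCount_map _ f c l fun a ha h => hf ha hc h]
      rfl
    rw [this]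
    exact Move.iso _ f (hf.mono fun a ha => List.mem_of_mem_filter ha)
  | shift A x y =>
    have h1 := hcv (fun c => altCount c u.letters = 0) fun c _ => by
      rw [altCount_shift hu, neg_eq_zero]
    by_cases hA : altCount A u.letters = 0
    · apply Homotopic.of_move
      rw [h1, hcu]
      simpa [List.filter_append, List.filter_cons, hA] using Move.shift A (x.filter _) (y.filter _)
    · apply Homotopic.of_eq
      rw [h1, hcu]
      simp [List.filter_append, hA]
  | h1 A x y =>
    obtain ⟨hx, hy⟩ := notMem_of_h1 hu
    have h1 := hcv (fun c => altCount c u.letters = 0) fun c hc => by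
      rw [altCount, signedCount_h1 hu neg_one_sign]
      rintro rfl
      simp [hx, hy] at hc
    apply Homotopic.of_move
    rw [h1, hcu]
    simpa [List.filter_append, List.filter_cons, altCount_h1 hu] using
      Move.h1 A (x.filter _) (y.filter _)
  | h2 A B x y z =>
    obtain ⟨hAB, ⟨h1, h2, h3⟩, h4, h5, h6⟩ := notMem_of_h2 hu
    have h1 := hcv (fun c => altCount c u.letters = 0) fun c hc => by
      rw [altCount, signedCount_h2 hu rfl neg_one_sign]
      · rintro rfl
        simp [*] at hc
      · rintro rfl
        simp [*] at hc
    have hP := altCount_h2 hu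
    by_cases hB : altCount B u.letters = 0
    · apply Homotopic.of_move
      rw [h1, hcu]
      simpa [List.filter_append, List.filter_cons, hB, hP] using
        Move.h2 A B (x.filter _) (y.filter _) (z.filter _)
    · apply Homotopic.of_eq
      rw [h1, hcu]
      simp [List.filter_append, hB, hP]
  | h3 A B C x y z t =>
    have h1 := hcv (fun c => altCount c u.letters = 0) fun c hc => by
      by_cases h : c = A ∨ c = B ∨ c = C
      · rw [altCount_h3 hu h, neg_eq_zero]
      · simp only [not_or] at h
        rw [altCount, signedCount_h3 _ _ _ _ _ h.1 h.2.1 h.2.2, hu]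
    rcases altCount_h3_eq_zero hu with ⟨hA, hB, hC⟩ | h
    · apply Homotopic.of_move
      rw [h1, hcu]
      simpa [List.filter_append, List.filter_cons, hA, hB, hC] using
        Move.h3 A B C (x.filter _) (y.filter _) (z.filter _) (t.filter _)
    · apply Homotopic.of_eq
      rw [h1, hcu]
      rcases h with ⟨hA, hB, hC⟩ | ⟨hA, hB, hC⟩ | ⟨hA, hB, hC⟩ <;>
        simp [List.filter_append, hA, hB, hC]

theorem Homotopic.cover {u v : GaussWord} (h : Homotopic u v) : Homotopic u.cover v.cover := by
  induction h with
  | rel _ _ h => exact homotopic_cover_of_move h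
  | refl _ => exact Relation.EqvGen.refl _
  | symm _ _ _ ih => exact Relation.EqvGen.symm _ _ ih
  | trans _ _ _ _ _ ih1 ih2 => exact Relation.EqvGen.trans _ _ _ ih1 ih2

theorem Homotopic.cover_iterate {u v : GaussWord} (h : Homotopic u v) (n : ℕ) :
    Homotopic (GaussWord.cover^[n] u) (GaussWord.cover^[n] v) := by
  induction n with
  | zero => exact h
  | succ n ih =>
    rw [Function.iterate_succ_apply', Function.iterate_succ_apply']
    exact ih.cover

theorem height_le_of_homotopic {u v : GaussWord} (h : Homotopic u v) : height u ≤ height v := by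
  have hv := Nat.sInf_mem (exists_homotopic_cover v)
  exact Nat.sInf_le (Relation.EqvGen.trans _ _ _ (h.cover_iterate _)
    (Relation.EqvGen.trans _ _ _ hv (Relation.EqvGen.symm _ _ (h.cover_iterate _))))

theorem Homotopic.height_eq {u v : GaussWord} (h : Homotopic u v) : height u = height v :=
  le_antisymm (height_le_of_homotopic h) (height_le_of_homotopic (Relation.EqvGen.symm _ _ h))

/-- Covering the lift gives back `w`, so a positive height of the lift exceeds that of `w`. If the
lift had height `0`, it would be homotopic to its covering `w`, and the heights would agree. -/
theorem height_lt_height_lift {w : GaussWord} (h : 0 < height w) : height w < height w.lift := by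
  have hm : Homotopic (GaussWord.cover^[height w.lift + 1] w.lift)
      (GaussWord.cover^[height w.lift] w.lift) :=
    Nat.sInf_mem (exists_homotopic_cover w.lift)
  rcases hn : height w.lift with _ | n
  · have h1 : Homotopic w w.lift := by simpa [hn, cover_lift] using hm
    have := h1.height_eq
    omega
  · rw [hn, Function.iterate_succ_apply _ (n + 1), Function.iterate_succ_apply _ n w.lift,
      cover_lift] at hm
    exact Nat.lt_succ_of_le (Nat.sInf_le hm)

/-! ### The alternating sum over odd letters -/

/-- The sign `-1` on the letters of even parity in `w`, and `1` on the others. Letters that do not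
appear in `w` count as even. -/
def evenSign (w : List ℕ) (a : ℕ) : ℤ := if altCount a w = 0 then -1 else 1

theorem evenSign_eq_or (w : List ℕ) (a : ℕ) : evenSign w a = 1 ∨ evenSign w a = -1 := by
  unfold evenSign
  split_ifs <;> simp

theorem evenSign_congr {u v : List ℕ} {a b : ℕ} (h : altCount a u = 0 ↔ altCount b v = 0) :
    evenSign u a = evenSign v b := by simp [evenSign, h]

/-- If `c` is odd in `w`, with occurrences at positions `p < q`, this is `4 * (-1) ^ (p + m)`, where
`m` is the number of even letters linked with `c`. Indeed the two occurrences of `c` contribute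
signs `ε`, `ε'` to the `evenSign`-signed count, and `(ε + ε') ^ 2 - 2 = 2 * ε * ε' = 2 * (-1) ^ m`.
If `c` is even, or absent from `w`, it is `0`. -/
def contribution (w : List ℕ) (c : ℕ) : ℤ :=
  altCount c w * (signedCount (evenSign w) c w ^ 2 - 2)

/-- The sum of the contributions of all letters of `w`. Up to sign it is a homotopy invariant. -/
def oddSum (w : List ℕ) : ℤ := ∑ c ∈ w.toFinset, contribution w c

theorem contribution_of_notMem {w : List ℕ} {c : ℕ} (h : c ∉ w) : contribution w c = 0 := by
  simp [contribution, altCount, signedCount_of_notMem _ h]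

theorem oddSum_eq_sum {w : List ℕ} {F : Finset ℕ} (h : w.toFinset ⊆ F) :
    oddSum w = ∑ c ∈ F, contribution w c :=
  Finset.sum_subset h fun _ _ hc => contribution_of_notMem fun h => hc (List.mem_toFinset.2 h)

theorem oddSum_map {u : List ℕ} {f : ℕ → ℕ} (hf : Set.InjOn f {a | a ∈ u}) :
    oddSum (u.map f) = oddSum u := by
  have hs : ∀ s, ∀ c ∈ u, signedCount s (f c) (u.map f) = signedCount (s ∘ f) c u :=
    fun s c hc => signedCount_map s f c u fun a ha h => hf ha hc h
  have h1 : (u.map f).toFinset = u.toFinset.image f := by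
    ext; simp
  rw [oddSum, h1, Finset.sum_image fun a ha b hb h =>
    hf (List.mem_toFinset.1 ha) (List.mem_toFinset.1 hb) h]
  refine Finset.sum_congr rfl fun c hc => ?_
  have hc := List.mem_toFinset.1 hc
  have he : signedCount (evenSign (u.map f) ∘ f) c u = signedCount (evenSign u) c u :=
    signedCount_congr c fun a ha => evenSign_congr (by
      rw [altCount, hs _ a ha]; rfl)
  rw [contribution, contribution, altCount, hs _ c hc, hs _ c hc, he]
  rfl

theorem oddSum_of_forall {u v : List ℕ} {σ : ℤ}
    (h : ∀ c, contribution v c = σ * contribution u c) :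
    oddSum v = σ * oddSum u := by
  rw [oddSum_eq_sum (Finset.subset_union_left (s₂ := u.toFinset)),
    oddSum_eq_sum (Finset.subset_union_right (s₁ := v.toFinset)), Finset.mul_sum]
  exact Finset.sum_congr rfl fun c _ => h c

/-- A shift changes the parity of the first position of every odd letter: the shifted letter, when
odd, moves from position `0` to a position equal to its gap. -/
theorem oddSum_shift {w : GaussWord} {A : ℕ} {x y : List ℕ}
    (h : w.letters = [A] ++ x ++ [A] ++ y) :
    oddSum (x ++ [A] ++ y ++ [A]) = -oddSum w.letters := by
  rw [← neg_one_mul]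
  refine oddSum_of_forall fun c => ?_
  have he : evenSign (x ++ [A] ++ y ++ [A]) = evenSign w.letters :=
    funext fun a => evenSign_congr (by rw [altCount_shift h, neg_eq_zero])
  have hA : evenSign w.letters A ^ 2 = 1 := by
    rcases evenSign_eq_or w.letters A with h | h <;> simp [h]
  rw [contribution, contribution, altCount_shift h, he,
    signedCount_shift h (evenSign_eq_or _), mul_pow, hA]
  ring

theorem oddSum_h1 {w : GaussWord} {A : ℕ} {x y : List ℕ}
    (h : w.letters = x ++ [A, A] ++ y) : oddSum (x ++ y) = oddSum w.letters := by
  rw [← one_mul (oddSum w.letters)]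
  refine oddSum_of_forall fun c => ?_
  obtain ⟨hx, hy⟩ := notMem_of_h1 h
  by_cases hc : c = A
  · subst hc
    rw [contribution_of_notMem (by simp [hx, hy]), contribution, altCount_h1 h]
    simp
  · have he : signedCount (evenSign (x ++ y)) c (x ++ y) =
        signedCount (evenSign w.letters) c (x ++ y) :=
      signedCount_congr c fun a ha => evenSign_congr (by
        rw [altCount, signedCount_h1 h neg_one_sign]
        rintro rfl
        simp [hx, hy] at ha)
    rw [contribution, contribution, he, altCount, signedCount_h1 h neg_one_sign hc,
      signedCount_h1 h (evenSign_eq_or _) hc, one_mul]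

/-- The letters deleted by the second move have the same parity and, when odd, are linked with
equally many even letters up to parity; they start at adjacent positions, so their contributions
cancel. -/
theorem contribution_h2 {w : GaussWord} {A B : ℕ} {x y z : List ℕ}
    (h : w.letters = x ++ [A, B] ++ y ++ [B, A] ++ z) :
    contribution w.letters A = -contribution w.letters B := by
  have hP := altCount_h2 h
  have he : evenSign w.letters A = evenSign w.letters B :=
    evenSign_congr (by rw [hP, neg_eq_zero])
  obtain ⟨hAB, ⟨h1, h2, h3⟩, h4, h5, h6⟩ := notMem_of_h2 h
  have hsq : signedCount (evenSign w.letters) A w.letters ^ 2 =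
      signedCount (evenSign w.letters) B w.letters ^ 2 := by
    have hsign := evenSign_eq_or w.letters
    generalize evenSign w.letters = s at he hsign
    rw [h]
    rcases signProd_eq_or s hsign x with hx | hx <;>
      rcases signProd_eq_or s hsign y with hy | hy <;>
      rcases hsign B with hB | hB <;>
      simp [signedCount_of_notMem, *, hAB.symm]
  rw [contribution, contribution, hP, hsq]
  ring

theorem oddSum_h2 {w : GaussWord} {A B : ℕ} {x y z : List ℕ}
    (h : w.letters = x ++ [A, B] ++ y ++ [B, A] ++ z) :
    oddSum (x ++ y ++ z) = oddSum w.letters := by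
  obtain ⟨hAB, ⟨h1, h2, h3⟩, h4, h5, h6⟩ := notMem_of_h2 h
  have hA : A ∉ x ++ y ++ z := by simp [*]
  have hB : B ∉ x ++ y ++ z := by simp [*]
  have hw : w.letters.toFinset = insert A (insert B (x ++ y ++ z).toFinset) := by
    rw [h]; ext; simp; tauto
  rw [oddSum, oddSum, hw, Finset.sum_insert (by simpa [hAB] using hA),
    Finset.sum_insert (by simpa using hB), contribution_h2 h, neg_add_cancel_left]
  refine Finset.sum_congr rfl fun c hc => ?_
  have hc := List.mem_toFinset.1 hc
  have hne : ∀ a ∈ x ++ y ++ z, a ≠ A ∧ a ≠ B := fun a ha =>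
    ⟨fun h => hA (h ▸ ha), fun h => hB (h ▸ ha)⟩
  have he : signedCount (evenSign (x ++ y ++ z)) c (x ++ y ++ z) =
      signedCount (evenSign w.letters) c (x ++ y ++ z) :=
    signedCount_congr c fun a ha => evenSign_congr (by
      rw [altCount, signedCount_h2 h rfl neg_one_sign (hne a ha).1 (hne a ha).2])
  rw [contribution, contribution, he, altCount,
    signedCount_h2 h rfl neg_one_sign (hne c hc).1 (hne c hc).2,
    signedCount_h2 h (evenSign_congr (by rw [altCount_h2 h, neg_eq_zero])) (evenSign_eq_or _)
      (hne c hc).1 (hne c hc).2]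

/-- With `s = evenSign w.letters` the hypotheses say that exactly one of `A`, `B`, `C` is even and
that `c` is one of the two others. The letter `c` is linked with that even letter either before or
after the move, but not both, so one of the two signed counts is `0` and the other `2` or `-2`. -/
theorem sq_signedCount_h3 {w : GaussWord} {A B C : ℕ} {x y z t : List ℕ}
    (h : w.letters = x ++ [A, B] ++ y ++ [A, C] ++ z ++ [B, C] ++ t) {s : ℕ → ℤ}
    (hs : ∀ a, s a = 1 ∨ s a = -1) (hABC : s A * s B * s C = -1) {c : ℕ}
    (hc : c = A ∨ c = B ∨ c = C) (hsc : s c = 1) :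
    signedCount s c (x ++ [B, A] ++ y ++ [C, A] ++ z ++ [C, B] ++ t) ^ 2 +
      signedCount s c w.letters ^ 2 = 4 := by
  obtain ⟨⟨hAB, hAC, hBC⟩, ⟨h1, h2, h3, h4⟩, ⟨h5, h6, h7, h8⟩, h9, h10, h11, h12⟩ :=
    notMem_of_h3 h
  rw [h]
  rcases hc with rfl | rfl | rfl
  · rcases signProd_eq_or s hs x with hx | hx <;> rcases signProd_eq_or s hs y with hy | hy <;>
      rcases hs B with hB | hB <;> simp [hB, hsc] at hABC <;>
      simp [signedCount_of_notMem, hsc, hx, hy, hB, hABC, h1, h2, h3, h4, hAB.symm, hAC.symm]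
  · rcases signProd_eq_or s hs x with hx | hx <;> rcases signProd_eq_or s hs y with hy | hy <;>
      rcases signProd_eq_or s hs z with hz | hz <;>
      rcases hs A with hA | hA <;> simp [hA, hsc] at hABC <;>
      simp [signedCount_of_notMem, hsc, hx, hy, hz, hA, hABC, h5, h6, h7, h8, hAB, hBC.symm]
  · rcases signProd_eq_or s hs x with hx | hx <;> rcases signProd_eq_or s hs y with hy | hy <;>
      rcases signProd_eq_or s hs z with hz | hz <;>
      rcases hs A with hA | hA <;> simp [hA, hsc] at hABC <;>
      simp [signedCount_of_notMem, hsc, hx, hy, hz, hA, hABC, h9, h10, h11, h12, hAC, hBC]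

/-- In a third move with two odd letters, each of these moves by one position and gains or loses a
linked even letter, so that its contribution does not change. -/
theorem oddSum_h3 {w : GaussWord} {A B C : ℕ} {x y z t : List ℕ}
    (h : w.letters = x ++ [A, B] ++ y ++ [A, C] ++ z ++ [B, C] ++ t) :
    oddSum (x ++ [B, A] ++ y ++ [C, A] ++ z ++ [C, B] ++ t) = oddSum w.letters := by
  rw [← one_mul (oddSum w.letters)]
  refine oddSum_of_forall fun c => ?_
  rw [one_mul]
  have he : evenSign (x ++ [B, A] ++ y ++ [C, A] ++ z ++ [C, B] ++ t) = evenSign w.letters :=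
    funext fun a => evenSign_congr (by
      by_cases ha : a = A ∨ a = B ∨ a = C
      · rw [altCount_h3 h ha, neg_eq_zero]
      · simp only [not_or] at ha
        rw [altCount, signedCount_h3 _ _ _ _ _ ha.1 ha.2.1 ha.2.2, h])
  by_cases hc : c = A ∨ c = B ∨ c = C
  · rw [contribution, contribution, altCount_h3 h hc, he]
    rcases eq_or_ne (altCount c w.letters) 0 with h0 | h0
    · simp [h0]
    have hABC : evenSign w.letters A * evenSign w.letters B * evenSign w.letters C = -1 := by
      rcases altCount_h3_eq_zero h with h' | h' | h' | h'
      · rcases hc with rfl | rfl | rfl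
        exacts [absurd h'.1 h0, absurd h'.2.1 h0, absurd h'.2.2 h0]
      all_goals simp [evenSign, h']
    have hsum := sq_signedCount_h3 h (evenSign_eq_or _) hABC hc (if_neg h0)
    rw [neg_mul, ← mul_neg]
    congr 1
    linarith
  · simp only [not_or] at hc
    rw [contribution, contribution, he, altCount,
      signedCount_h3 _ _ _ _ _ hc.1 hc.2.1 hc.2.2,
      signedCount_h3 _ _ _ _ _ hc.1 hc.2.1 hc.2.2, h]

theorem sq_oddSum_of_move {u v : GaussWord} (h : Move u.letters v.letters) :
    oddSum u.letters ^ 2 = oddSum v.letters ^ 2 := by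
  generalize hu : u.letters = l at h
  generalize hv : v.letters = l' at h
  cases h with
  | iso _ f hf => rw [oddSum_map hf]
  | shift A x y => rw [oddSum_shift hu, hu, neg_sq]
  | h1 A x y => rw [oddSum_h1 hu, hu]
  | h2 A B x y z => rw [oddSum_h2 hu, hu]
  | h3 A B C x y z t => rw [oddSum_h3 hu, hu]

theorem Homotopic.sq_oddSum_eq {u v : GaussWord} (h : Homotopic u v) :
    oddSum u.letters ^ 2 = oddSum v.letters ^ 2 := by
  induction h with
  | rel _ _ h => exact sq_oddSum_of_move h
  | refl _ => rfl
  | symm _ _ _ ih => exact ih.symm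
  | trans _ _ _ _ _ ih1 ih2 => exact ih1.trans ih2

/-! ### The lifts of the example word -/

theorem height_exampleWord_pos : 0 < height exampleWord := by
  rw [Nat.pos_iff_ne_zero]
  intro h0
  have h : Homotopic exampleWord.cover exampleWord := by
    have := Nat.sInf_mem (exists_homotopic_cover exampleWord)
    rw [show sInf _ = 0 from h0] at this
    exact this
  -- All four odd letters contribute `4`, while the covering `DD` has no odd letter.
  have h1 : oddSum exampleWord.letters = 16 := by decide
  have h2 : oddSum exampleWord.cover.letters = 0 := by decide
  have := h.sq_oddSum_eq
  rw [h1, h2] at this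
  norm_num at this

theorem height_iterate_lift_pos (i : ℕ) : 0 < height (lift^[i] exampleWord) := by
  induction i with
  | zero => exact height_exampleWord_pos
  | succ i ih =>
    rw [Function.iterate_succ_apply']
    exact ih.trans (height_lt_height_lift ih)

end GaussWord

theorem proposition5p6 :
    Infinite GaussWord.HomotopyClass ∧
      (∀ w : GaussWord, w.lift.cover = w) ∧
      StrictMono (fun i : ℕ => (GaussWord.lift^[i] GaussWord.exampleWord).height) ∧
      (∀ i j : ℕ, i ≠ j →
        ¬ GaussWord.Homotopic (GaussWord.lift^[i] GaussWord.exampleWord)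
            (GaussWord.lift^[j] GaussWord.exampleWord)) := by
  have hmono : StrictMono fun i : ℕ =>
      (GaussWord.lift^[i] GaussWord.exampleWord).height := by
    refine strictMono_nat_of_lt_succ fun i => ?_
    rw [Function.iterate_succ_apply']
    exact GaussWord.height_lt_height_lift (GaussWord.height_iterate_lift_pos i)
  have hne : ∀ i j : ℕ, i ≠ j →
      ¬ GaussWord.Homotopic (GaussWord.lift^[i] GaussWord.exampleWord)
          (GaussWord.lift^[j] GaussWord.exampleWord) :=
    fun i j hij h => hij (hmono.injective h.height_eq)
  refine ⟨?_, GaussWord.cover_lift, hmono, hne⟩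
  refine Infinite.of_injective (fun i : ℕ =>
    (Quotient.mk GaussWord.homotopySetoid (GaussWord.lift^[i] GaussWord.exampleWord) :
      GaussWord.HomotopyClass)) fun i j h => ?_
  by_contra hij
  exact hne i j hij (Quotient.exact h)
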